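/- Let $(W,S)$ be a Coxeter system with $W$ finite, and let $o$ be the identity of $W$. For nonnegative rates $\mathbf r=(r_s)_{s\in S}$, consider the continuous-time random walk on $W$ that starts at $o$ and jumps from its current position $x$ to $xs$ at each ring of a Poisson clock of rate $r_s$, the clocks being independent for different $s\in S$; let $p_t(x,y;\mathbf r)$ be its transition probabilities. Let $\mathbf r,\mathbf r'$ be two sets of nonnegative rates with $r_s\le r'_s$ for all $s\in S$, and let $t>0$. Then $f:=p_t(o,\cdot\,;\mathbf r)$ majorizes $f':=p_t(o,\cdot\,;\mathbf r')$; that is, with $f_{[1]}\ge\dots\ge f_{[n]}$ and $f'_{[1]}\ge\dots\ge f'_{[n]}$ the decreasing rearrangements ($n=|W|$), $f_{[1]}+\dots+f_{[i]}\ge f'_{[1]}+\dots+f'_{[i]}$ for $1\le i\le n$, with equality for $i=n$. If $\mathbf r\ne\mathbf r'$, the majorization is strict: $f'$ does not majorize $f$. Consequently, with $u\equiv 1/n$ the uniform distribution on $W$: $\|f'-u\|_p\le\|f-u\|_p$ for every $p\in[1,\infty]$; $\bigl(\tfrac12\sum_v|\sqrt{f'(v)}-\sqrt{u(v)}|^2\bigr)^{1/2}\le\bigl(\tfrac12\sum_v|\sqrt{f(v)}-\sqrt{u(v)}|^2\bigr)^{1/2}$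 (Hellinger distance); and $-\sum_v f(v)\log f(v)\le-\sum_v f'(v)\log f'(v)$ (entropy). If $\mathbf r\ne\mathbf r'$, then the $\ell^p$ inequalities with $1<p<\infty$, the Hellinger inequality and the entropy inequality are strict. -/

import Mathlib

namespace CoxeterWalk

section Majorization

variable {ι : Type*} [Fintype ι]

/-- An enumeration of the index set `ι` along which the values of `f` decrease. -/
noncomputable def sortEnum (f : ι → ℝ) : Fin (Fintype.card ι) ≃ ι :=
  (Tuple.sort (fun i => -f ((Fintype.equivFin ι).symm i))).trans (Fintype.equivFin ι).symm

/-- The decreasing rearrangement `f_[1] ≥ f_[2] ≥ ⋯ ≥ f_[n]` of `f`, indexed from `0` here. -/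
noncomputable def decRearr (f : ι → ℝ) (i : Fin (Fintype.card ι)) : ℝ :=
  f (sortEnum f i)

theorem decRearr_antitone (f : ι → ℝ) : Antitone (decRearr f) := by
  intro i j hij
  have h := Tuple.monotone_sort (fun i => -f ((Fintype.equivFin ι).symm i)) hij
  simpa [decRearr, sortEnum] using h

/-- `f_[1] + ⋯ + f_[k]`, the sum of the `k` largest entries of `f` (for `k ≤ n`). -/
noncomputable def topSum (f : ι → ℝ) (k : ℕ) : ℝ :=
  ∑ i : Fin (Fintype.card ι) with i.val < k, decRearr f i

/-- `f` majorizes `g`: each partial sum of the decreasing rearrangement of `f` is at least the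
one of `g`, with equality for the total sums. -/
def Majorizes (f g : ι → ℝ) : Prop :=
  (∀ k ≤ Fintype.card ι, topSum g k ≤ topSum f k) ∧
    topSum f (Fintype.card ι) = topSum g (Fintype.card ι)

/-- `f` majorizes `g` strictly: `g` does not majorize `f` in turn (that is, `f` and `g` are not
rearrangements of each other). -/
def StrictlyMajorizes (f g : ι → ℝ) : Prop :=
  Majorizes f g ∧ ¬ Majorizes g f

/-- The `ℓ^p`-distance, for real `p ≥ 1`. -/
noncomputable def lpDist (p : ℝ) (f g : ι → ℝ) : ℝ :=
  (∑ v, |f v - g v| ^ p) ^ (1 / p)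

/-- The `ℓ^∞`-distance (a maximum, as `ι` is finite). -/
noncomputable def linftyDist (f g : ι → ℝ) : ℝ :=
  ⨆ v, |f v - g v|

/-- The Hellinger distance. -/
noncomputable def hellingerDist (f g : ι → ℝ) : ℝ :=
  Real.sqrt (1 / 2 * ∑ v, |Real.sqrt (f v) - Real.sqrt (g v)| ^ 2)

/-- The entropy `∑ -f(v) log f(v)` (with `0 log 0 = 0`). -/
noncomputable def entropy (f : ι → ℝ) : ℝ :=
  ∑ v, -(f v * Real.log (f v))

/-- The uniform distribution on `ι`. -/
noncomputable def uniform (ι : Type*) [Fintype ι] : ι → ℝ :=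
  fun _ => 1 / (Fintype.card ι : ℝ)

end Majorization

section Walk

variable {B W : Type*} [Group W] [Fintype B] [Fintype W] [DecidableEq W] {M : CoxeterMatrix B}

/-- The generator (matrix of jump rates) of the walk that moves from its current position `x` to
`x * s` whenever the Poisson clock of the simple reflection `s`, of rate `r s`, rings. -/
noncomputable def generator (cs : CoxeterSystem M W) (r : B → ℝ) : Matrix W W ℝ :=
  Matrix.of fun x y =>
    ∑ s : B, r s * ((if y = x * cs.simple s then 1 else 0) - (if y = x then 1 else 0))

/-- The transition probability `p_t(x, y; r)` of the continuous-time random walk on `W`: the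
`(x, y)` entry of `exp (t Q)`, where `Q` is the generator. -/
noncomputable def transProb (cs : CoxeterSystem M W) (r : B → ℝ) (t : ℝ) (x y : W) : ℝ :=
  NormedSpace.exp (t • generator cs r) x y

end Walk

end CoxeterWalk

open CoxeterWalk

/-! Call a function on `W` decreasing if reflecting its argument away from the identity never raises
it. These functions form a closed cone containing `δ_1` and stable under `f ↦ f(· s) + f`
(`average_mem_decreasingCone`), hence under both semigroups. For decreasing `c`, interpolate between
the walks by `⟨exp(uQ) δ_1, exp((t-u)Q') c⟩`. The `u`-derivative is a sum over edges of `r' - r`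
times products of increments of two decreasing functions. These increments have equal signs, so
`⟨f', c⟩ ≤ ⟨f, c⟩` (`dotProduct_transProb_le`). Taking `c = ψ(f')` with `ψ` monotone, in particular
a subgradient of a convex `φ`, gives `∑ φ(f') ≤ ∑ φ(f)` (`SpreadsOver.sum_le`). Majorization and all
the distances are instances. Strictness needs only `f ≠ f'`, seen at the identity
(`transProb_one_one_lt`). -/

namespace CoxeterWalk

/-! ### Walls: the side of a reflection on which an element lies -/

section Reflections

variable {B W : Type*} [Group W] [DecidableEq W] {M : CoxeterMatrix B}

/-- The permutation `(t, ε) ↦ (s t s, ε + [t = s])` of `W × ZMod 2` attached to an involution `s`. -/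
def signedConj (s : W) (hs : s * s = 1) : Equiv.Perm (W × ZMod 2) where
  toFun p := (s * p.1 * s, p.2 + if p.1 = s then 1 else 0)
  invFun p := (s * p.1 * s, p.2 + if p.1 = s then 1 else 0)
  left_inv := by
    rintro ⟨t, e⟩
    have h1 : s * (s * t * s) * s = t := by
      rw [show s * (s * t * s) * s = (s * s) * t * (s * s) by group, hs]; simp
    have h2 : s * t * s = s ↔ t = s := by
      constructor
      · intro h; rw [h, hs, one_mul] at h1; exact h1.symm
      · rintro rfl; rw [hs, one_mul]
    have h3 : (1 : ZMod 2) + 1 = 0 := by decide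
    simp only [h1, h2, Prod.mk.injEq, true_and]
    split_ifs <;> simp [add_assoc, h3]
  right_inv := by
    rintro ⟨t, e⟩
    have h1 : s * (s * t * s) * s = t := by
      rw [show s * (s * t * s) * s = (s * s) * t * (s * s) by group, hs]; simp
    have h2 : s * t * s = s ↔ t = s := by
      constructor
      · intro h; rw [h, hs, one_mul] at h1; exact h1.symm
      · rintro rfl; rw [hs, one_mul]
    have h3 : (1 : ZMod 2) + 1 = 0 := by decide
    simp only [h1, h2, Prod.mk.injEq, true_and]
    split_ifs <;> simp [add_assoc, h3]

@[simp] theorem signedConj_apply (s : W) (hs : s * s = 1) (p : W × ZMod 2) :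
    signedConj s hs p = (s * p.1 * s, p.2 + if p.1 = s then 1 else 0) := rfl

theorem signedConj_mul_pow_apply (a b : W) (ha : a * a = 1) (hb : b * b = 1) (k : ℕ)
    (t : W) (e : ZMod 2) :
    ((signedConj a ha * signedConj b hb) ^ k) (t, e) =
      ((a * b) ^ k * t * ((a * b) ^ k)⁻¹,
        e + ∑ i ∈ Finset.range (2 * k), if t = b * (a * b) ^ i then 1 else 0) := by
  have ha' : a⁻¹ = a := inv_eq_of_mul_eq_one_left ha
  have hb' : b⁻¹ = b := inv_eq_of_mul_eq_one_left hb
  have hconj : ∀ n : ℕ, b * (a * b) ^ n = ((a * b) ^ n)⁻¹ * b := by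
    intro n
    induction n with
    | zero => simp
    | succ n ih =>
      rw [pow_succ, ← mul_assoc, ih, ← pow_succ, pow_succ', mul_inv_rev, mul_inv_rev, ha', hb']
      have : b * (a * b) = b * a * b := by group
      simp only [mul_assoc]
  induction k with
  | zero => simp
  | succ k ih =>
    rw [pow_succ', Equiv.Perm.mul_apply, ih, Equiv.Perm.mul_apply, signedConj_apply,
      signedConj_apply]
    set c := a * b with hc
    have e1 : c ^ k * t * (c ^ k)⁻¹ = b ↔ t = b * c ^ (2 * k) := by
      rw [two_mul, pow_add, ← mul_assoc, hconj, mul_inv_eq_iff_eq_mul, mul_assoc,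
        eq_inv_mul_iff_mul_eq]
    have e2 : b * (c ^ k * t * (c ^ k)⁻¹) * b = a ↔ t = b * c ^ (2 * k + 1) := by
      rw [← eq_mul_inv_iff_mul_eq, ← eq_inv_mul_iff_mul_eq, hb', ← hc, mul_inv_eq_iff_eq_mul,
        ← eq_inv_mul_iff_mul_eq, ← mul_assoc, ← mul_assoc, ← hconj,
        show 2 * k + 1 = k + 1 + k by ring, pow_add, pow_succ]
      simp only [mul_assoc]
    simp only [e1, e2]
    rw [show 2 * (k + 1) = 2 * k + 1 + 1 by ring, Finset.sum_range_succ, Finset.sum_range_succ]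
    refine Prod.ext ?_ ?_
    · have hp : c ^ (k + 1) = a * (b * c ^ k) := by rw [pow_succ', hc, mul_assoc]
      simp only [hp, mul_inv_rev, ha', hb', mul_assoc]
    · simp only [add_assoc]

/-- Since `(ab)^m = 1`, the `2m` reflections `b(ab)^i` repeat with period `m`; each is counted twice
and cancels mod 2. -/
theorem signedConj_isLiftable (cs : CoxeterSystem M W) :
    M.IsLiftable fun i => signedConj (cs.simple i) (cs.simple_mul_simple_self i) := by
  intro i j
  ext1 ⟨t, e⟩
  rw [signedConj_mul_pow_apply, cs.simple_mul_simple_pow, two_mul, Finset.sum_range_add]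
  simp only [pow_add, cs.simple_mul_simple_pow, one_mul]
  rw [CharTwo.add_self_eq_zero]
  simp

/-- The action of `W` on `W × ZMod 2` that records the inversions of an element. -/
def signedConjHom (cs : CoxeterSystem M W) : W →* Equiv.Perm (W × ZMod 2) :=
  cs.lift ⟨_, signedConj_isLiftable cs⟩

/-- For a reflection `t`, the side of the wall of `t` on which `x` lies: `0` if it is the side of
the identity, `1` otherwise. -/
def side (cs : CoxeterSystem M W) (x t : W) : ZMod 2 :=
  (signedConjHom cs x⁻¹ (t, 0)).2

theorem signedConjHom_simple (cs : CoxeterSystem M W) (i : B) :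
    signedConjHom cs (cs.simple i) = signedConj (cs.simple i) (cs.simple_mul_simple_self i) :=
  cs.lift_apply_simple (signedConj_isLiftable cs) i

theorem signedConjHom_apply (cs : CoxeterSystem M W) (x t : W) (e : ZMod 2) :
    signedConjHom cs x (t, e) = (x * t * x⁻¹, e + side cs x⁻¹ t) := by
  have key : ∀ (t : W) (e : ZMod 2), (signedConjHom cs x (t, e)).1 = x * t * x⁻¹ ∧
      (signedConjHom cs x (t, e)).2 = e + (signedConjHom cs x (t, 0)).2 := by
    induction x using cs.simple_induction_left with
    | one => simp
    | mul_simple_left w i ih =>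
      intro t e
      rw [map_mul, Equiv.Perm.mul_apply, Equiv.Perm.mul_apply, signedConjHom_simple,
        signedConj_apply, signedConj_apply, (ih t e).1, (ih t e).2, (ih t 0).1]
      simp [mul_assoc, add_assoc]
  rw [side, inv_inv]
  exact Prod.ext (key t e).1 (key t e).2

@[simp] theorem side_one (cs : CoxeterSystem M W) (t : W) : side cs 1 t = 0 := by
  simp [side]

theorem side_mul (cs : CoxeterSystem M W) (x y t : W) :
    side cs (x * y) t = side cs x t + side cs y (x⁻¹ * t * x) := by
  rw [side, mul_inv_rev, map_mul, Equiv.Perm.mul_apply, signedConjHom_apply, signedConjHom_apply]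
  simp

theorem side_simple (cs : CoxeterSystem M W) (i : B) (t : W) :
    side cs (cs.simple i) t = if t = cs.simple i then 1 else 0 := by
  simp [side, signedConjHom_simple]

/-- An edge of the Cayley graph crosses exactly one wall, that of the reflection exchanging its
ends. -/
theorem side_mul_simple (cs : CoxeterSystem M W) (x t : W) (i : B) :
    side cs (x * cs.simple i) t =
      side cs x t + if t = x * cs.simple i * x⁻¹ then 1 else 0 := by
  rw [side_mul, side_simple]
  congr 2
  rw [eq_mul_inv_iff_mul_eq, mul_assoc, inv_mul_eq_iff_eq_mul]

/-- Along `t = w s w⁻¹` the crossings due to `w` and `w⁻¹` cancel, leaving the one at `s`. -/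
theorem side_self (cs : CoxeterSystem M W) {t : W} (ht : cs.IsReflection t) : side cs t t = 1 := by
  obtain ⟨w, i, rfl⟩ := ht
  have h := side_mul cs w w⁻¹ (w * cs.simple i * w⁻¹)
  rw [mul_inv_cancel, side_one] at h
  rw [side_mul, side_mul_simple, if_pos rfl, add_right_comm]
  have e : (w * cs.simple i)⁻¹ * (w * cs.simple i * w⁻¹) * (w * cs.simple i) =
      w⁻¹ * (w * cs.simple i * w⁻¹) * w := by simp [mul_assoc]
  rw [e, ← h, zero_add]

end Reflections

end CoxeterWalk

namespace CoxeterWalk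

open NormedSpace Matrix

/-! ### Matrix exponentials, invariant cones and interpolation -/

section MatrixExponential

variable {ι : Type*} [Fintype ι] [DecidableEq ι]

open scoped Matrix.Norms.Operator in
theorem hasSum_exp_mulVec (A : Matrix ι ι ℝ) (v : ι → ℝ) :
    HasSum (fun n : ℕ => (n.factorial : ℝ)⁻¹ • (A ^ n *ᵥ v)) (exp A *ᵥ v) := by
  have h : HasSum (fun n : ℕ => ((n.factorial : ℝ)⁻¹ • A ^ n) *ᵥ v) (exp A *ᵥ v) :=
    (exp_series_hasSum_exp' (𝕂 := ℝ) A).map (Matrix.mulVecBilin ℝ ℝ |>.flip v) (by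
      change Continuous fun B : Matrix ι ι ℝ => B *ᵥ v
      fun_prop)
  simpa only [Matrix.smul_mulVec] using h

/-- All terms of the exponential series lie in the cone, so the zeroth may be dropped. This surplus
over mere invariance is what later yields a strict inequality. -/
theorem exp_mulVec_sub_mem (K : PointedCone ℝ (ι → ℝ)) (hK : IsClosed (K : Set (ι → ℝ)))
    {A : Matrix ι ι ℝ} (hA : ∀ v ∈ K, A *ᵥ v ∈ K) {v : ι → ℝ} (hv : v ∈ K) :
    exp A *ᵥ v - v ∈ K := by
  have hpow : ∀ n : ℕ, A ^ n *ᵥ v ∈ K := by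
    intro n
    induction n with
    | zero => simpa using hv
    | succ n ih => rw [pow_succ', ← Matrix.mulVec_mulVec]; exact hA _ ih
  have h := (hasSum_nat_add_iff' 1).2 (hasSum_exp_mulVec A v)
  simp only [Finset.range_one, Finset.sum_singleton, Nat.factorial_zero, Nat.cast_one, inv_one,
    pow_zero, Matrix.one_mulVec, one_smul] at h
  refine hK.mem_of_tendsto h (Filter.Eventually.of_forall fun s => K.sum_mem fun n _ => ?_)
  exact K.smul_mem (by positivity) (hpow _)

open scoped Matrix.Norms.Operator in
theorem hasDerivAt_exp_smul_mulVec (A : Matrix ι ι ℝ) (v : ι → ℝ) (u : ℝ) :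
    HasDerivAt (fun u : ℝ => exp (u • A) *ᵥ v) (A *ᵥ (exp (u • A) *ᵥ v)) u := by
  have h := (LinearMap.toContinuousLinearMap (Matrix.mulVecBilin ℝ ℝ |>.flip v :
    Matrix ι ι ℝ →ₗ[ℝ] (ι → ℝ))).hasFDerivAt.comp_hasDerivAt u
      (hasDerivAt_exp_smul_const' (𝕂 := ℝ) A u)
  rw [Matrix.mulVec_mulVec]
  exact h

theorem hasDerivAt_exp_smul_dotProduct {A : Matrix ι ι ℝ} (hA : A.IsSymm) (B : Matrix ι ι ℝ)
    (v w : ι → ℝ) (t u : ℝ) :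
    HasDerivAt (fun u : ℝ => (exp (u • A) *ᵥ v) ⬝ᵥ (exp ((t - u) • B) *ᵥ w))
      ((exp (u • A) *ᵥ v) ⬝ᵥ ((A - B) *ᵥ (exp ((t - u) • B) *ᵥ w))) u := by
  have h1 := hasDerivAt_exp_smul_mulVec A v u
  have h2 : HasDerivAt (fun u : ℝ => exp ((t - u) • B) *ᵥ w)
      (-(B *ᵥ (exp ((t - u) • B) *ᵥ w))) u := by
    have h := (hasDerivAt_exp_smul_mulVec B w (t - u)).scomp u ((hasDerivAt_id u).const_sub t)
    rw [neg_one_smul] at h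
    exact h
  have h := HasDerivAt.fun_sum (u := Finset.univ) fun i _ =>
    ((hasDerivAt_pi.1 h1) i).mul ((hasDerivAt_pi.1 h2) i)
  refine h.congr_deriv ?_
  rw [Finset.sum_add_distrib, Matrix.sub_mulVec, dotProduct_sub, sub_eq_add_neg]
  congr 1
  · change A *ᵥ _ ⬝ᵥ _ = _
    rw [dotProduct_mulVec _ A, ← mulVec_transpose, hA.eq]
  · change _ ⬝ᵥ (-_) = _
    rw [dotProduct_neg]

end MatrixExponential

/-! ### The generator, its positivity and its Dirichlet form -/

section Generator

variable {B W : Type*} [Group W] [Fintype B] [Fintype W] [DecidableEq W] {M : CoxeterMatrix B}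

theorem generator_isSymm {B W : Type*} [Group W] [Fintype B] [DecidableEq W]
    {M : CoxeterMatrix B} (cs : CoxeterSystem M W) (r : B → ℝ) : (generator cs r).IsSymm := by
  ext x y
  simp only [transpose_apply, generator, of_apply]
  refine Finset.sum_congr rfl fun s _ => ?_
  have h : x = y * cs.simple s ↔ y = x * cs.simple s := by
    constructor <;> rintro rfl <;> simp
  simp only [h, eq_comm (a := x) (b := y)]

theorem generator_mulVec (cs : CoxeterSystem M W) (r : B → ℝ) (f : W → ℝ) (x : W) :
    (generator cs r *ᵥ f) x = ∑ s, r s * (f (x * cs.simple s) - f x) := by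
  simp only [mulVec, dotProduct, generator, of_apply, Finset.sum_mul]
  rw [Finset.sum_comm]
  refine Finset.sum_congr rfl fun s _ => ?_
  simp [mul_assoc, ← Finset.mul_sum, sub_mul, Finset.sum_sub_distrib]

theorem transProb_one_eq (cs : CoxeterSystem M W) (r : B → ℝ) (t : ℝ) :
    transProb cs r t 1 = exp (t • generator cs r) *ᵥ Pi.single 1 1 := by
  ext y
  have h := (((generator_isSymm cs r).smul t).exp).apply y 1
  rw [mulVec_single_one]
  exact h

/-- The shift by `2 ∑ r_s` turns each `f(xs) - f(x)` into `f(xs) + f(x)`, at the cost of a positive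
scalar factor. -/
theorem exp_smul_generator (cs : CoxeterSystem M W) (r : B → ℝ) (t : ℝ) :
    exp (t • (generator cs r + (2 * ∑ s, r s) • 1)) =
      Real.exp (t * (2 * ∑ s, r s)) • exp (t • generator cs r) := by
  have hd : exp ((t * (2 * ∑ s, r s)) • (1 : Matrix W W ℝ)) =
      Real.exp (t * (2 * ∑ s, r s)) • 1 := by
    rw [smul_one_eq_diagonal, Matrix.exp_diagonal, smul_one_eq_diagonal]
    congr 1
    ext i
    rw [Pi.exp_def, Real.exp_eq_exp_ℝ]
  rw [smul_add, smul_smul, Matrix.exp_add_of_commute _ _ (Commute.smul_right (.one_right _) _), hd,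
    mul_smul_comm, mul_one]

theorem exp_generator_mulVec_sub_mem (cs : CoxeterSystem M W) {K : PointedCone ℝ (W → ℝ)}
    (hK : IsClosed (K : Set (W → ℝ)))
    (hs : ∀ s, ∀ f ∈ K, (fun x => f (x * cs.simple s) + f x) ∈ K)
    {r : B → ℝ} (hr : ∀ s, 0 ≤ r s) {t : ℝ} (ht : 0 ≤ t) {f : W → ℝ} (hf : f ∈ K) :
    Real.exp (t * (2 * ∑ s, r s)) • (exp (t • generator cs r) *ᵥ f) - f ∈ K := by
  rw [← Matrix.smul_mulVec, ← exp_smul_generator]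
  refine exp_mulVec_sub_mem K hK (fun v hv => ?_) hf
  have h : (t • (generator cs r + (2 * ∑ s, r s) • 1)) *ᵥ v =
      ∑ s, (⟨t * r s, mul_nonneg ht (hr s)⟩ : {c : ℝ // 0 ≤ c}) •
        (fun x => v (x * cs.simple s) + v x) := by
    ext x
    rw [Matrix.smul_mulVec, Matrix.add_mulVec, Matrix.smul_mulVec, Matrix.one_mulVec]
    simp only [Pi.smul_apply, Pi.add_apply, generator_mulVec, Finset.sum_apply, smul_eq_mul,
      Finset.mul_sum, Finset.sum_mul, ← Finset.sum_add_distrib, Nonneg.mk_smul]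
    refine Finset.sum_congr rfl fun s _ => ?_
    ring
  rw [h]
  exact K.sum_mem fun s _ => K.smul_mem (mul_nonneg ht (hr s)) (hs s v hv)

theorem exp_generator_mulVec_mem (cs : CoxeterSystem M W) {K : PointedCone ℝ (W → ℝ)}
    (hK : IsClosed (K : Set (W → ℝ)))
    (hs : ∀ s, ∀ f ∈ K, (fun x => f (x * cs.simple s) + f x) ∈ K)
    {r : B → ℝ} (hr : ∀ s, 0 ≤ r s) {t : ℝ} (ht : 0 ≤ t) {f : W → ℝ} (hf : f ∈ K) :
    exp (t • generator cs r) *ᵥ f ∈ K := by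
  have h := K.add_mem (exp_generator_mulVec_sub_mem cs hK hs hr ht hf) hf
  rw [sub_add_cancel] at h
  have h' := K.smul_mem (inv_nonneg.2 (Real.exp_pos (t * (2 * ∑ s, r s))).le) h
  rwa [inv_smul_smul₀ (Real.exp_pos _).ne'] at h'

theorem transProb_nonneg (cs : CoxeterSystem M W) {r : B → ℝ} (hr : ∀ s, 0 ≤ r s) {t : ℝ}
    (ht : 0 ≤ t) (x : W) : 0 ≤ transProb cs r t 1 x := by
  rw [transProb_one_eq]
  have h := exp_generator_mulVec_mem cs (K := PointedCone.positive ℝ (W → ℝ)) (r := r) (t := t)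
    (f := Pi.single 1 1) ?_ ?_ hr ht ?_
  · exact (PointedCone.mem_positive ℝ (W → ℝ)).1 h x
  · exact isClosed_Ici
  · intro s f hf
    rw [PointedCone.mem_positive] at hf ⊢
    exact fun x => add_nonneg (hf _) (hf _)
  · rw [PointedCone.mem_positive]
    exact Pi.single_nonneg.2 zero_le_one

/-- Summation by parts: `x ↦ xs` is an involution, so every edge occurs twice, whence the `1/2`. -/
theorem dotProduct_generator_sub_mulVec (cs : CoxeterSystem M W) (r r' : B → ℝ) (g h : W → ℝ) :
    g ⬝ᵥ ((generator cs r - generator cs r') *ᵥ h) =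
      ∑ s, (r' s - r s) / 2 *
        ∑ x, (g x - g (x * cs.simple s)) * (h x - h (x * cs.simple s)) := by
  have key : ∀ s, ∑ x, (g x - g (x * cs.simple s)) * (h x - h (x * cs.simple s)) =
      2 * ∑ x, g x * (h x - h (x * cs.simple s)) := by
    intro s
    have e : ∑ x, g (x * cs.simple s) * (h x - h (x * cs.simple s)) =
        -∑ x, g x * (h x - h (x * cs.simple s)) := by
      rw [← Equiv.sum_comp (Equiv.mulRight (cs.simple s)), ← Finset.sum_neg_distrib]
      refine Finset.sum_congr rfl fun x _ => ?_
      simp only [Equiv.coe_mulRight, cs.simple_mul_simple_cancel_right]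
      ring
    simp only [sub_mul (g _), Finset.sum_sub_distrib, e]
    ring
  simp only [key]
  simp only [dotProduct, Matrix.sub_mulVec, Pi.sub_apply, generator_mulVec,
    ← Finset.sum_sub_distrib, Finset.mul_sum]
  rw [Finset.sum_comm]
  refine Finset.sum_congr rfl fun s _ => Finset.sum_congr rfl fun x _ => ?_
  ring

end Generator

/-! ### The cone of decreasing functions -/

section Decreasing

variable {B W : Type*} [Group W] [DecidableEq W] {M : CoxeterMatrix B}

/-- The cone of the functions on `W` that do not increase when the argument is reflected away from
the identity, that is, of the functions decreasing in the Bruhat order. -/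
def decreasingCone (cs : CoxeterSystem M W) : PointedCone ℝ (W → ℝ) where
  carrier := {f | ∀ t x, cs.IsReflection t → side cs x t = 0 → f (t * x) ≤ f x}
  add_mem' hf hg t x ht hx := add_le_add (hf t x ht hx) (hg t x ht hx)
  zero_mem' _ _ _ _ := le_rfl
  smul_mem' c _ hf t x ht hx := mul_le_mul_of_nonneg_left (hf t x ht hx) c.2

theorem isClosed_decreasingCone (cs : CoxeterSystem M W) :
    IsClosed (decreasingCone cs : Set (W → ℝ)) := by
  change IsClosed {f : W → ℝ | ∀ t x, cs.IsReflection t → side cs x t = 0 → f (t * x) ≤ f x}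
  simp only [Set.ofPred_forall]
  exact isClosed_iInter fun t => isClosed_iInter fun x => isClosed_iInter fun _ =>
    isClosed_iInter fun _ => isClosed_le (continuous_apply _) (continuous_apply _)

theorem comp_mem_decreasingCone {cs : CoxeterSystem M W} {f : W → ℝ} (hf : f ∈ decreasingCone cs)
    {ψ : ℝ → ℝ} {D : Set ℝ} (hfD : ∀ x, f x ∈ D) (hψ : MonotoneOn ψ D) :
    (fun x => ψ (f x)) ∈ decreasingCone cs :=
  fun t x ht hx => hψ (hfD _) (hfD _) (hf t x ht hx)

/-- Either `t` exchanges `x` and `xs`, and the two sums agree, or `x` and `xs` lie on the same side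
of `t`, and the inequalities add. -/
theorem average_mem_decreasingCone (cs : CoxeterSystem M W) (s : B) (f : W → ℝ)
    (hf : f ∈ decreasingCone cs) :
    (fun x => f (x * cs.simple s) + f x) ∈ decreasingCone cs := by
  intro t x ht hx
  have h := side_mul_simple cs x t s
  by_cases hts : t = x * cs.simple s * x⁻¹
  · have e1 : t * x = x * cs.simple s := by rw [hts]; simp
    have e2 : t * x * cs.simple s = x := by rw [e1]; simp
    simp only [e2]
    rw [e1, add_comm]
  · rw [if_neg hts, add_zero, hx] at h
    simp only [mul_assoc]
    exact add_le_add (hf t _ ht h) (hf t x ht hx)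

theorem single_one_mem_decreasingCone (cs : CoxeterSystem M W) :
    (Pi.single 1 1 : W → ℝ) ∈ decreasingCone cs := by
  intro t x ht hx
  by_cases h : t * x = 1
  · have : x = t := by rw [eq_inv_of_mul_eq_one_right h, ht.inv]
    subst this
    rw [side_self cs ht] at hx
    exact absurd hx one_ne_zero
  · rw [Pi.single_eq_of_ne h]
    have h0 : (0 : W → ℝ) ≤ Pi.single 1 1 := Pi.single_nonneg.2 zero_le_one
    exact h0 x

theorem mul_sub_nonneg_of_mem_decreasingCone {cs : CoxeterSystem M W} {g h : W → ℝ}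
    (hg : g ∈ decreasingCone cs) (hh : h ∈ decreasingCone cs) (x : W) (s : B) :
    0 ≤ (g x - g (x * cs.simple s)) * (h x - h (x * cs.simple s)) := by
  set t := x * cs.simple s * x⁻¹ with ht
  have htr : cs.IsReflection t := ⟨x, s, rfl⟩
  have e1 : t * x = x * cs.simple s := by simp [ht]
  have e2 : t * (x * cs.simple s) = x := by rw [← mul_assoc, e1]; simp
  have hsd := side_mul_simple cs x t s
  rw [if_pos ht] at hsd
  have hcases : ∀ a : ZMod 2, a = 0 ∨ a + 1 = 0 := by decide
  rcases hcases (side cs x t) with h0 | h0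
  · have hg' := hg t x htr h0
    have hh' := hh t x htr h0
    rw [e1] at hg' hh'
    exact mul_nonneg (sub_nonneg.2 hg') (sub_nonneg.2 hh')
  · rw [h0] at hsd
    have hg' := hg t _ htr hsd
    have hh' := hh t _ htr hsd
    rw [e2] at hg' hh'
    exact mul_nonneg_of_nonpos_of_nonpos (sub_nonpos.2 hg') (sub_nonpos.2 hh')

end Decreasing

/-! ### Comparison of the two walks -/

section Comparison

variable {B W : Type*} [Group W] [Fintype B] [Fintype W] [DecidableEq W] {M : CoxeterMatrix B}

theorem exp_generator_mulVec_mem_decreasingCone (cs : CoxeterSystem M W) {r : B → ℝ}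
    (hr : ∀ s, 0 ≤ r s) {t : ℝ} (ht : 0 ≤ t) {f : W → ℝ} (hf : f ∈ decreasingCone cs) :
    exp (t • generator cs r) *ᵥ f ∈ decreasingCone cs :=
  exp_generator_mulVec_mem cs (isClosed_decreasingCone cs) (average_mem_decreasingCone cs) hr ht hf

theorem transProb_mem_decreasingCone (cs : CoxeterSystem M W) {r : B → ℝ}
    (hr : ∀ s, 0 ≤ r s) {t : ℝ} (ht : 0 ≤ t) : transProb cs r t 1 ∈ decreasingCone cs := by
  rw [transProb_one_eq]
  exact exp_generator_mulVec_mem_decreasingCone cs hr ht (single_one_mem_decreasingCone cs)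

/-- A positive multiple of the law remains decreasing after `δ_1` is subtracted, which forces a gap
between `1` and `s`. -/
theorem transProb_simple_lt (cs : CoxeterSystem M W) {r : B → ℝ}
    (hr : ∀ s, 0 ≤ r s) {t : ℝ} (ht : 0 ≤ t) (s : B) :
    transProb cs r t 1 (cs.simple s) < transProb cs r t 1 1 := by
  have h := exp_generator_mulVec_sub_mem cs (isClosed_decreasingCone cs)
    (average_mem_decreasingCone cs) hr ht (single_one_mem_decreasingCone cs)
    (cs.simple s) 1 (cs.isReflection_simple s) (side_one cs _)
  have hne : cs.simple s ≠ 1 := by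
    intro h1
    have := cs.length_simple s
    rw [h1, cs.length_one] at this
    exact zero_ne_one this
  rw [← transProb_one_eq, mul_one] at h
  simp only [Pi.sub_apply, Pi.smul_apply, smul_eq_mul, Pi.single_eq_same,
    Pi.single_eq_of_ne hne] at h
  have hpos := Real.exp_pos (t * (2 * ∑ s, r s))
  by_contra hcon
  have := mul_le_mul_of_nonneg_left (not_lt.1 hcon) hpos.le
  linarith

theorem dotProduct_transProb_le (cs : CoxeterSystem M W) {r r' : B → ℝ}
    (hr : ∀ s, 0 ≤ r s) (hrr' : ∀ s, r s ≤ r' s) {t : ℝ} (ht : 0 ≤ t)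
    {c : W → ℝ} (hc : c ∈ decreasingCone cs) :
    transProb cs r' t 1 ⬝ᵥ c ≤ transProb cs r t 1 ⬝ᵥ c := by
  have hr' : ∀ s, 0 ≤ r' s := fun s => (hr s).trans (hrr' s)
  have hd := fun u => hasDerivAt_exp_smul_dotProduct (generator_isSymm cs r) (generator cs r')
    (Pi.single 1 1) c t u
  have hmono := monotoneOn_of_deriv_nonneg (convex_Icc 0 t)
    (fun u _ => (hd u).continuousAt.continuousWithinAt)
    (fun u _ => (hd u).differentiableAt.differentiableWithinAt) (fun u hu => by
      rw [interior_Icc] at hu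
      rw [(hd u).deriv, dotProduct_generator_sub_mulVec]
      refine Finset.sum_nonneg fun s _ => mul_nonneg (by linarith [hrr' s])
        (Finset.sum_nonneg fun x _ => mul_sub_nonneg_of_mem_decreasingCone ?_ ?_ x s)
      · exact exp_generator_mulVec_mem_decreasingCone cs hr hu.1.le
          (single_one_mem_decreasingCone cs)
      · exact exp_generator_mulVec_mem_decreasingCone cs hr' (by linarith [hu.2]) hc)
  have h := hmono (Set.left_mem_Icc.2 ht) (Set.right_mem_Icc.2 ht) ht
  simp only [zero_smul, exp_zero, one_mulVec, sub_zero, sub_self] at h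
  rw [transProb_one_eq, transProb_one_eq]
  refine le_trans (le_of_eq ?_) h
  rw [dotProduct_mulVec, ← mulVec_transpose, (((generator_isSymm cs r').smul t).exp).eq]

theorem transProb_one_one_lt (cs : CoxeterSystem M W) {r r' : B → ℝ}
    (hr : ∀ s, 0 ≤ r s) (hrr' : ∀ s, r s ≤ r' s) {t : ℝ} (ht : 0 < t)
    (hne : r ≠ r') :
    transProb cs r' t 1 1 < transProb cs r t 1 1 := by
  have hr' : ∀ s, 0 ≤ r' s := fun s => (hr s).trans (hrr' s)
  obtain ⟨s₀, hs₀⟩ : ∃ s, r s < r' s := by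
    by_contra! hcon
    exact hne (funext fun s => le_antisymm (hrr' s) (hcon s))
  have hd := fun u => hasDerivAt_exp_smul_dotProduct (generator_isSymm cs r) (generator cs r')
    (Pi.single 1 1) (Pi.single 1 1) t u
  have hmono := strictMonoOn_of_deriv_pos (convex_Icc 0 t)
    (fun u _ => (hd u).continuousAt.continuousWithinAt) (fun u hu => by
      rw [interior_Icc] at hu
      rw [(hd u).deriv, dotProduct_generator_sub_mulVec, ← transProb_one_eq, ← transProb_one_eq]
      have hu' : 0 ≤ t - u := by linarith [hu.2]
      have hnn : ∀ s x, 0 ≤ (transProb cs r u 1 x - transProb cs r u 1 (x * cs.simple s)) *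
          (transProb cs r' (t - u) 1 x - transProb cs r' (t - u) 1 (x * cs.simple s)) :=
        fun s x => mul_sub_nonneg_of_mem_decreasingCone
          (transProb_mem_decreasingCone cs hr hu.1.le) (transProb_mem_decreasingCone cs hr' hu') x s
      refine Finset.sum_pos' (fun s _ => mul_nonneg (by linarith [hrr' s])
        (Finset.sum_nonneg fun x _ => hnn s x)) ⟨s₀, Finset.mem_univ _, mul_pos (by linarith)
          -- The edge from `1` to `s₀` makes the derivative positive: both laws drop strictly along
          -- it.
          (Finset.sum_pos' (fun x _ => hnn s₀ x) ⟨1, Finset.mem_univ _, ?_⟩)⟩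
      rw [one_mul]
      exact mul_pos (sub_pos.2 (transProb_simple_lt cs hr hu.1.le s₀))
        (sub_pos.2 (transProb_simple_lt cs hr' hu' s₀)))
  have h := hmono (Set.left_mem_Icc.2 ht.le) (Set.right_mem_Icc.2 ht.le) ht
  simp only [zero_smul, exp_zero, one_mulVec, sub_zero, sub_self] at h
  rwa [← transProb_one_eq, ← transProb_one_eq, dotProduct_single_one, single_one_dotProduct] at h

end Comparison

end CoxeterWalk

namespace CoxeterWalk

/-! ### From monotone test functions to convex sums -/

section Convexity

/-- The right derivative serves. The point `y = 0` is left out because the slope may be `-∞` there,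
as for `x log x`. -/
theorem exists_subgradient {φ : ℝ → ℝ} (hφ : ConvexOn ℝ (Set.Ici 0) φ) :
    ∃ c : ℝ → ℝ, MonotoneOn c (Set.Ioi 0) ∧
      ∀ y > 0, ∀ x ≥ 0, c y * (x - y) ≤ φ x - φ y := by
  refine ⟨fun y => derivWithin φ (Set.Ioi y) y, ?_, fun y hy x hx => ?_⟩
  · simpa only [interior_Ici] using hφ.monotoneOn_rightDeriv
  · have hyi : y ∈ interior (Set.Ici (0 : ℝ)) := by rwa [interior_Ici]
    rcases lt_trichotomy x y with h | rfl | h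
    · have h1 := (hφ.slope_le_leftDeriv_of_mem_interior hx hyi h).trans
        (hφ.leftDeriv_le_rightDeriv_of_mem_interior hyi)
      rw [slope_def_field, div_le_iff₀ (sub_pos.2 h)] at h1
      linarith
    · simp
    · have h1 := hφ.rightDeriv_le_slope_of_mem_interior hyi hx h
      rwa [slope_def_field, le_div_iff₀ (sub_pos.2 h)] at h1

variable {ι : Type*} [Fintype ι] {f g : ι → ℝ}

/-- The mass that `f` and `g` give to functions that are monotone in `g` is in the order that
makes `f` more spread out than `g`. -/
def SpreadsOver (f g : ι → ℝ) : Prop :=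
  ∀ ψ : ℝ → ℝ, Monotone ψ → ∑ v, g v * ψ (g v) ≤ ∑ v, f v * ψ (g v)

theorem SpreadsOver.sum_eq (h : SpreadsOver f g) : ∑ v, g v = ∑ v, f v := by
  have h1 := h (fun _ => 1) monotone_const
  have h2 := h (fun _ => -1) monotone_const
  simp only [mul_one, mul_neg, Finset.sum_neg_distrib] at h1 h2
  linarith

theorem SpreadsOver.eq_zero (h : SpreadsOver f g) (hf : ∀ v, 0 ≤ f v) (hg : ∀ v, 0 ≤ g v) {v : ι}
    (hv : g v = 0) : f v = 0 := by
  -- The indicator of `(0, ∞)` shows that `f` has all its mass where `g > 0`.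
  have h1 := h (fun x => if 0 < x then 1 else 0) (fun x y hxy => by
    dsimp only
    split_ifs with hx hy
    · exact le_rfl
    · exact absurd (hx.trans_le hxy) hy
    · exact zero_le_one
    · exact le_rfl)
  have h2 : ∑ w, g w * (if 0 < g w then 1 else 0) = ∑ w, g w := by
    refine Finset.sum_congr rfl fun w _ => ?_
    split_ifs with hw
    · rw [mul_one]
    · rw [mul_zero]
      exact (hg w).antisymm (not_lt.1 hw)
  rw [h2, h.sum_eq, ← sub_nonpos, ← Finset.sum_sub_distrib] at h1
  have hnn : ∀ w ∈ Finset.univ, 0 ≤ f w - f w * (if 0 < g w then 1 else 0) := by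
    intro w _
    split_ifs
    · simp
    · simpa using hf w
  have h3 := (Finset.sum_eq_zero_iff_of_nonneg hnn).1 (h1.antisymm (Finset.sum_nonneg hnn)) v
    (Finset.mem_univ v)
  simpa [hv] using h3

theorem SpreadsOver.exists_sum_nonneg (h : SpreadsOver f g) (hf : ∀ v, 0 ≤ f v)
    (hg : ∀ v, 0 ≤ g v) {φ : ℝ → ℝ} (hφ : ConvexOn ℝ (Set.Ici 0) φ) :
    ∃ c : ι → ℝ, 0 ≤ ∑ v, c v * (f v - g v) ∧
      ∀ v, (g v = 0 ∧ f v = 0) ∨ ∀ x ≥ 0, c v * (x - g v) ≤ φ x - φ (g v) := by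
  obtain ⟨c, hcm, hc⟩ := exists_subgradient hφ
  -- Freezing the subgradient below the least positive value `m` of `g` makes it monotone on all of
  -- `ℝ` and leaves it unchanged at the positive values of `g`.
  obtain ⟨m, hm, hmg⟩ : ∃ m > 0, ∀ v, 0 < g v → m ≤ g v := by
    by_cases hne : (Finset.univ.filter fun v => 0 < g v).Nonempty
    · obtain ⟨w, hw, hmin⟩ := Finset.exists_min_image _ g hne
      exact ⟨g w, (Finset.mem_filter.1 hw).2, fun v hv => hmin v (by simpa using hv)⟩
    · refine ⟨1, one_pos, fun v hv => absurd ⟨v, ?_⟩ hne⟩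
      simpa using hv
  refine ⟨fun v => c (max (g v) m), ?_, fun v => ?_⟩
  · have h1 := h (fun x => c (max x m)) fun x y hxy =>
      hcm (lt_max_of_lt_right hm) (lt_max_of_lt_right hm) (max_le_max_right m hxy)
    rw [← sub_nonneg, ← Finset.sum_sub_distrib] at h1
    refine h1.trans_eq (Finset.sum_congr rfl fun v _ => ?_)
    ring
  · rcases (hg v).eq_or_lt with hv | hv
    · exact Or.inl ⟨hv.symm, h.eq_zero hf hg hv.symm⟩
    · right
      simp only [max_eq_left (hmg v hv)]
      exact hc _ hv

theorem SpreadsOver.sum_le (h : SpreadsOver f g) (hf : ∀ v, 0 ≤ f v) (hg : ∀ v, 0 ≤ g v)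
    {φ : ℝ → ℝ} (hφ : ConvexOn ℝ (Set.Ici 0) φ) : ∑ v, φ (g v) ≤ ∑ v, φ (f v) := by
  obtain ⟨c, hc, hcv⟩ := h.exists_sum_nonneg hf hg hφ
  rw [← sub_nonneg, ← Finset.sum_sub_distrib]
  refine hc.trans (Finset.sum_le_sum fun v _ => ?_)
  rcases hcv v with ⟨h1, h2⟩ | h1
  · simp [h1, h2]
  · exact h1 _ (hf v)

theorem SpreadsOver.sum_lt (h : SpreadsOver f g) (hf : ∀ v, 0 ≤ f v) (hg : ∀ v, 0 ≤ g v)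
    {φ : ℝ → ℝ} (hφ : StrictConvexOn ℝ (Set.Ici 0) φ) (hne : f ≠ g) :
    ∑ v, φ (g v) < ∑ v, φ (f v) := by
  obtain ⟨c, hc, hcv⟩ := h.exists_sum_nonneg hf hg hφ.convexOn
  rw [← sub_pos, ← Finset.sum_sub_distrib]
  refine hc.trans_lt (Finset.sum_lt_sum (fun v _ => ?_) ?_)
  · rcases hcv v with ⟨h1, h2⟩ | h1
    · simp [h1, h2]
    · exact h1 _ (hf v)
  · obtain ⟨v, hv⟩ := Function.ne_iff.1 hne
    refine ⟨v, Finset.mem_univ v, ?_⟩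
    rcases hcv v with ⟨h1, h2⟩ | h1
    · exact absurd (h2.trans h1.symm) hv
    -- The subgradient inequality at the midpoint, combined with strict convexity there, is strict
    -- at `f v`.
    · have hmid := hφ.2 (hf v) (hg v) hv (one_half_pos (α := ℝ)) (one_half_pos (α := ℝ))
        (by norm_num)
      simp only [smul_eq_mul] at hmid
      have := h1 (1 / 2 * f v + 1 / 2 * g v) (by linarith [hf v, hg v])
      nlinarith

end Convexity

/-! ### Partial sums of the decreasing rearrangement -/

section TopSums

variable {ι : Type*} [Fintype ι]

theorem sum_comp_decRearr (f : ι → ℝ) (φ : ℝ → ℝ) : ∑ i, φ (decRearr f i) = ∑ v, φ (f v) :=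
  Equiv.sum_comp (sortEnum f) fun v => φ (f v)

theorem topSum_card (f : ι → ℝ) : topSum f (Fintype.card ι) = ∑ v, f v := by
  rw [topSum, Finset.filter_true_of_mem fun i _ => i.2]
  exact sum_comp_decRearr f id

theorem topSum_succ (f : ι → ℝ) (i : Fin (Fintype.card ι)) :
    topSum f (i + 1) = topSum f i + decRearr f i := by
  have h : (Finset.univ.filter fun j : Fin (Fintype.card ι) => j.val < i.val + 1) =
      insert i (Finset.univ.filter fun j : Fin (Fintype.card ι) => j.val < i.val) := by
    ext j
    simp only [Finset.mem_filter, Finset.mem_univ, true_and, Finset.mem_insert, Fin.ext_iff]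
    omega
  rw [topSum, h, Finset.sum_insert (by simp), add_comm]
  rfl

theorem card_filter_val_lt {n k : ℕ} (hk : k ≤ n) :
    (Finset.univ.filter fun i : Fin n => i.val < k).card = k := by
  rw [Fin.card_filter_val_lt, min_eq_right hk]

/-- With `topSum_eq`, for `k ≥ 1` this makes the top sum the minimum over `b` of a constant plus a
sum of convex functions `(x - b)⁺`, attained at the `k`-th largest value. -/
theorem topSum_le (f : ι → ℝ) {k : ℕ} (hk : k ≤ Fintype.card ι) (b : ℝ) :
    topSum f k ≤ k * b + ∑ v, max (f v - b) 0 := by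
  rw [← sum_comp_decRearr f fun x => max (x - b) 0]
  calc topSum f k
      ≤ ∑ i : Fin (Fintype.card ι) with i.val < k, (b + max (decRearr f i - b) 0) :=
        Finset.sum_le_sum fun i _ => by linarith [le_max_left (decRearr f i - b) 0]
    _ = k * b + ∑ i : Fin (Fintype.card ι) with i.val < k, max (decRearr f i - b) 0 := by
        rw [Finset.sum_add_distrib, Finset.sum_const, card_filter_val_lt hk, nsmul_eq_mul]
    _ ≤ _ := by
        gcongr
        exact Finset.filter_subset _ _

theorem topSum_eq (f : ι → ℝ) (i : Fin (Fintype.card ι)) :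
    topSum f (i + 1) =
      (i + 1 : ℕ) * decRearr f i + ∑ v, max (f v - decRearr f i) 0 := by
  set b := decRearr f i
  rw [← sum_comp_decRearr f fun x => max (x - b) 0,
    ← Finset.sum_filter_add_sum_filter_not Finset.univ (fun j => j.val < i.val + 1)
      fun j => max (decRearr f j - b) 0]
  have h1 : ∑ j : Fin (Fintype.card ι) with ¬ j.val < i.val + 1, max (decRearr f j - b) 0 = 0 :=
    Finset.sum_eq_zero fun j hj => max_eq_right <| sub_nonpos.2 <| decRearr_antitone f <| by
      have := (Finset.mem_filter.1 hj).2
      rw [Fin.le_def]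
      omega
  have h2 : ∑ j : Fin (Fintype.card ι) with j.val < i.val + 1, max (decRearr f j - b) 0 =
      ∑ j : Fin (Fintype.card ι) with j.val < i.val + 1, (decRearr f j - b) :=
    Finset.sum_congr rfl fun j hj => max_eq_left <| sub_nonneg.2 <| decRearr_antitone f <| by
      have := (Finset.mem_filter.1 hj).2
      rw [Fin.le_def]
      omega
  rw [h1, h2, Finset.sum_sub_distrib, Finset.sum_const, card_filter_val_lt i.2, nsmul_eq_mul, topSum]
  ring

theorem decRearr_eq_of_majorizes {f g : ι → ℝ} (h : Majorizes f g) (h' : Majorizes g f) :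
    decRearr f = decRearr g := by
  ext i
  have h1 := topSum_succ f i
  have h2 := topSum_succ g i
  rw [(h'.1 _ i.2).antisymm (h.1 _ i.2), (h'.1 _ i.2.le).antisymm (h.1 _ i.2.le)] at h1
  linarith

variable {f g : ι → ℝ}

theorem SpreadsOver.majorizes (h : SpreadsOver f g) (hf : ∀ v, 0 ≤ f v) (hg : ∀ v, 0 ≤ g v) :
    Majorizes f g := by
  refine ⟨fun k hk => ?_, by rw [topSum_card, topSum_card, h.sum_eq]⟩
  obtain _ | k := k
  · simp [topSum]
  · rw [topSum_eq f ⟨k, hk⟩]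
    refine (topSum_le g hk (decRearr f ⟨k, hk⟩)).trans (add_le_add le_rfl ?_)
    refine h.sum_le hf hg (φ := fun x => max (x - decRearr f ⟨k, hk⟩) 0) ?_
    exact ((convexOn_id (convex_Ici 0)).sub (concaveOn_const _ (convex_Ici 0))).sup
      (convexOn_const _ (convex_Ici 0))

theorem SpreadsOver.strictlyMajorizes (h : SpreadsOver f g) (hf : ∀ v, 0 ≤ f v)
    (hg : ∀ v, 0 ≤ g v) (hne : f ≠ g) : StrictlyMajorizes f g := by
  refine ⟨h.majorizes hf hg, fun hm => ?_⟩
  have h1 := decRearr_eq_of_majorizes (h.majorizes hf hg) hm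
  -- The sum of squares is invariant under rearrangement, yet differs strictly.
  have h2 := h.sum_lt hf hg (strictConvexOn_rpow one_lt_two) hne
  rw [← sum_comp_decRearr f fun x : ℝ => x ^ (2 : ℝ), h1,
    sum_comp_decRearr g fun x : ℝ => x ^ (2 : ℝ)] at h2
  exact lt_irrefl _ h2

end TopSums

/-! ### Distances to uniform and entropy as convex sums -/

section Distances

theorem convexOn_abs_sub (u : ℝ) : ConvexOn ℝ (Set.Ici 0) fun x : ℝ => |x - u| := by
  have h := (convexOn_id (𝕜 := ℝ) (convex_Ici (0 : ℝ))).sub (concaveOn_const u (convex_Ici 0))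
  exact h.sup ((concaveOn_id (𝕜 := ℝ) (convex_Ici (0 : ℝ))).sub
    (convexOn_const u (convex_Ici 0))).neg

theorem convexOn_abs_sub_rpow (u : ℝ) {p : ℝ} (hp : 1 ≤ p) :
    ConvexOn ℝ (Set.Ici 0) fun x : ℝ => |x - u| ^ p := by
  refine ⟨convex_Ici 0, fun x hx y hy a b ha hb hab => ?_⟩
  have h1 := (convexOn_abs_sub u).2 hx hy ha hb hab
  refine (Real.rpow_le_rpow (abs_nonneg _) h1 (by linarith)).trans ?_
  exact (convexOn_rpow hp).2 (Set.mem_Ici.2 (abs_nonneg _)) (Set.mem_Ici.2 (abs_nonneg _)) ha hb hab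

theorem strictConvexOn_abs_sub_rpow (u : ℝ) {p : ℝ} (hp : 1 < p) :
    StrictConvexOn ℝ (Set.Ici 0) fun x : ℝ => |x - u| ^ p := by
  refine ⟨convex_Ici 0, fun x hx y hy hxy a b ha hb hab => ?_⟩
  by_cases he : |x - u| = |y - u|
  -- Here `x` and `y` are mirror images in `u`, and a proper convex combination is strictly closer
  -- to `u`. Otherwise strictness comes from the power.
  · have hopp : x - u = -(y - u) := (abs_eq_abs.1 he).resolve_left fun h => hxy (by linarith)
    have hy0 : 0 < |y - u| := abs_pos.2 fun h => hxy (by linarith)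
    have hrhs : a • |x - u| ^ p + b • |y - u| ^ p = |y - u| ^ p := by
      rw [he, ← add_smul, hab, one_smul]
    simp only [hrhs]
    refine Real.rpow_lt_rpow (abs_nonneg _) ?_ (by linarith)
    have e : a • x + b • y - u = (b - a) * (y - u) := by
      simp only [smul_eq_mul]
      obtain rfl : b = 1 - a := by linarith
      linear_combination a * hopp
    rw [e, abs_mul]
    have : |b - a| < 1 := abs_lt.2 ⟨by linarith, by linarith⟩
    nlinarith
  · have h1 := (convexOn_abs_sub u).2 hx hy ha.le hb.le hab
    refine (Real.rpow_le_rpow (abs_nonneg _) h1 (by linarith)).trans_lt ?_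
    exact (strictConvexOn_rpow hp).2 (Set.mem_Ici.2 (abs_nonneg _)) (Set.mem_Ici.2 (abs_nonneg _))
      he ha hb hab

theorem strictConvexOn_sqrt_sub_sq {u : ℝ} (hu : 0 < u) :
    StrictConvexOn ℝ (Set.Ici 0) fun x : ℝ => |√x - √u| ^ 2 := by
  refine ⟨convex_Ici 0, fun x hx y hy hxy a b ha hb hab => ?_⟩
  have h := Real.strictConcaveOn_sqrt.2 hx hy hxy ha hb hab
  rw [Set.mem_Ici] at hx hy
  have hsu := Real.sqrt_pos.2 hu
  -- An affine function minus a positive multiple of the strictly concave square root.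
  have e : ∀ z : ℝ, 0 ≤ z → |√z - √u| ^ 2 = z + u - 2 * (√u * √z) := fun z hz => by
    rw [sq_abs, sub_sq, Real.sq_sqrt hz, Real.sq_sqrt hu.le]
    ring
  simp only [smul_eq_mul] at h ⊢
  rw [e x hx, e y hy, e _ (by positivity)]
  have h' := mul_lt_mul_of_pos_left h hsu
  obtain rfl : b = 1 - a := by linarith
  linarith

variable {ι : Type*} [Fintype ι] {f g : ι → ℝ}

theorem SpreadsOver.lpDist_le (h : SpreadsOver f g) (hf : ∀ v, 0 ≤ f v) (hg : ∀ v, 0 ≤ g v) {p : ℝ}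
    (hp : 1 ≤ p) : lpDist p g (uniform ι) ≤ lpDist p f (uniform ι) := by
  refine Real.rpow_le_rpow (by positivity) ?_ (by positivity)
  exact h.sum_le hf hg (convexOn_abs_sub_rpow (1 / Fintype.card ι) hp)

theorem SpreadsOver.lpDist_lt (h : SpreadsOver f g) (hf : ∀ v, 0 ≤ f v) (hg : ∀ v, 0 ≤ g v)
    (hne : f ≠ g) {p : ℝ} (hp : 1 < p) : lpDist p g (uniform ι) < lpDist p f (uniform ι) := by
  refine Real.rpow_lt_rpow (by positivity) ?_ (by positivity)
  exact h.sum_lt hf hg (strictConvexOn_abs_sub_rpow (1 / Fintype.card ι) hp) hne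

theorem SpreadsOver.linftyDist_le [Nonempty ι] (h : SpreadsOver f g) (hf : ∀ v, 0 ≤ f v)
    (hg : ∀ v, 0 ≤ g v) : linftyDist g (uniform ι) ≤ linftyDist f (uniform ι) := by
  set S := linftyDist f (uniform ι) with hS
  have hfS : ∀ v, |f v - 1 / Fintype.card ι| ≤ S := fun v =>
    le_ciSup (f := fun v => |f v - uniform ι v|) (Set.finite_range _).bddAbove v
  -- This convex excess over `S` vanishes at every value of `f`, so its sum over the values of `g`
  -- must vanish too.
  have h1 := h.sum_le hf hg (φ := fun x => max (|x - 1 / Fintype.card ι| - S) 0)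
    (((convexOn_abs_sub _).sub (concaveOn_const S (convex_Ici 0))).sup
      (convexOn_const 0 (convex_Ici 0)))
  rw [Finset.sum_eq_zero (f := fun v => max (|f v - 1 / Fintype.card ι| - S) 0) fun v _ =>
    max_eq_right (sub_nonpos.2 (hfS v))] at h1
  refine ciSup_le fun v => ?_
  have h2 := (Finset.single_le_sum (f := fun v => max (|g v - 1 / Fintype.card ι| - S) 0)
    (fun _ _ => le_max_right _ _) (Finset.mem_univ v)).trans h1
  exact sub_nonpos.1 ((le_max_left _ _).trans h2)

theorem SpreadsOver.hellingerDist_le [Nonempty ι] (h : SpreadsOver f g) (hf : ∀ v, 0 ≤ f v)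
    (hg : ∀ v, 0 ≤ g v) : hellingerDist g (uniform ι) ≤ hellingerDist f (uniform ι) := by
  refine Real.sqrt_le_sqrt (mul_le_mul_of_nonneg_left ?_ (by norm_num))
  exact h.sum_le hf hg (strictConvexOn_sqrt_sub_sq (u := 1 / Fintype.card ι) (by positivity)).convexOn

theorem SpreadsOver.hellingerDist_lt [Nonempty ι] (h : SpreadsOver f g) (hf : ∀ v, 0 ≤ f v)
    (hg : ∀ v, 0 ≤ g v) (hne : f ≠ g) :
    hellingerDist g (uniform ι) < hellingerDist f (uniform ι) := by
  refine Real.sqrt_lt_sqrt (by positivity) (mul_lt_mul_of_pos_left ?_ (by norm_num))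
  exact h.sum_lt hf hg (strictConvexOn_sqrt_sub_sq (u := 1 / Fintype.card ι) (by positivity)) hne

theorem SpreadsOver.entropy_le (h : SpreadsOver f g) (hf : ∀ v, 0 ≤ f v) (hg : ∀ v, 0 ≤ g v) :
    entropy f ≤ entropy g := by
  have h1 := h.sum_le hf hg Real.strictConvexOn_mul_log.convexOn
  simpa only [entropy, Finset.sum_neg_distrib, neg_le_neg_iff] using h1

theorem SpreadsOver.entropy_lt (h : SpreadsOver f g) (hf : ∀ v, 0 ≤ f v) (hg : ∀ v, 0 ≤ g v)
    (hne : f ≠ g) : entropy f < entropy g := by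
  have h1 := h.sum_lt hf hg Real.strictConvexOn_mul_log hne
  simpa only [entropy, Finset.sum_neg_distrib, neg_lt_neg_iff] using h1

end Distances

theorem spreadsOver_transProb {B W : Type*} [Group W] [Fintype B] [Fintype W] [DecidableEq W]
    {M : CoxeterMatrix B} (cs : CoxeterSystem M W) {r r' : B → ℝ}
    (hr : ∀ s, 0 ≤ r s) (hrr' : ∀ s, r s ≤ r' s) {t : ℝ} (ht : 0 ≤ t) :
    SpreadsOver (transProb cs r t 1) (transProb cs r' t 1) := fun _ hψ =>
  dotProduct_transProb_le cs hr hrr' ht <| comp_mem_decreasingCone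
    (transProb_mem_decreasingCone cs (fun s => (hr s).trans (hrr' s)) ht)
    (fun _ => Set.mem_univ _) (hψ.monotoneOn _)

end CoxeterWalk

theorem theoremt {B W : Type*} [Group W] [Fintype B] [Fintype W] [DecidableEq W]
    {M : CoxeterMatrix B} (cs : CoxeterSystem M W) (r r' : B → ℝ)
    (hr : ∀ s, 0 ≤ r s) (hrr' : ∀ s, r s ≤ r' s) (t : ℝ) (ht : 0 < t) :
    -- majorization, strict when the rates differ
    Majorizes (transProb cs r t 1) (transProb cs r' t 1) ∧
    (r ≠ r' → StrictlyMajorizes (transProb cs r t 1) (transProb cs r' t 1)) ∧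
    -- consequences for the distances to uniform and for the entropy
    (∀ p : ℝ, 1 ≤ p →
      lpDist p (transProb cs r' t 1) (uniform W) ≤ lpDist p (transProb cs r t 1) (uniform W)) ∧
    linftyDist (transProb cs r' t 1) (uniform W) ≤
      linftyDist (transProb cs r t 1) (uniform W) ∧
    hellingerDist (transProb cs r' t 1) (uniform W) ≤
      hellingerDist (transProb cs r t 1) (uniform W) ∧
    entropy (transProb cs r t 1) ≤ entropy (transProb cs r' t 1) ∧
    -- the consequences that come from a strictly convex function are strict
    (r ≠ r' →
      (∀ p : ℝ, 1 < p →
        lpDist p (transProb cs r' t 1) (uniform W) <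
          lpDist p (transProb cs r t 1) (uniform W)) ∧
      hellingerDist (transProb cs r' t 1) (uniform W) <
        hellingerDist (transProb cs r t 1) (uniform W) ∧
      entropy (transProb cs r t 1) < entropy (transProb cs r' t 1)) := by
  have hr' : ∀ s, 0 ≤ r' s := fun s => (hr s).trans (hrr' s)
  have hf := transProb_nonneg cs hr ht.le
  have hg := transProb_nonneg cs hr' ht.le
  have h := spreadsOver_transProb cs hr hrr' ht.le
  have hne : r ≠ r' → transProb cs r t 1 ≠ transProb cs r' t 1 := fun hne heq =>
    (transProb_one_one_lt cs hr hrr' ht hne).ne' (congrFun heq 1)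
  exact ⟨h.majorizes hf hg, fun hn => h.strictlyMajorizes hf hg (hne hn),
    fun _ hp => h.lpDist_le hf hg hp, h.linftyDist_le hf hg, h.hellingerDist_le hf hg,
    h.entropy_le hf hg, fun hn => ⟨fun _ hp => h.lpDist_lt hf hg (hne hn) hp,
      h.hellingerDist_lt hf hg (hne hn), h.entropy_lt hf hg (hne hn)⟩⟩
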